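/- Let $p$ be an odd prime and let $G$ be a finite group that is nilpotent of class at most $2$ and of exponent $p$. Let $n>1$ and suppose that $G$ is minimally generated by $g_1,\dots,g_n$, that is, $g_1,\dots,g_n$ generate $G$ and $G$ cannot be generated by fewer than $n$ elements. Write $[x,y]=x^{-1}y^{-1}xy$. Let $F$ be the free product of $n$ cyclic groups $\langle x_1\rangle,\dots,\langle x_n\rangle$ of order $p$, let $F_1=F$, $F_{k+1}=[F_k,F]$, and let $\mathcal G=F/F_3$ be their $2$-nilpotent product. Let $N$ be the kernel of the natural homomorphism $\mathcal G\to G$ with $x_i\mapsto g_i$ for all $i$. Let $V$ be the $\mathbb F_p$-vector space with basis $\{v_{ji} : 1\le i<j\le n\}$, and let $W$ be the $\mathbb F_p$-vector space with basis $\{w_{jik} : 1\le i<j\le n,\ i\le k\le n\}$. For $r=1,\dots,n$ let $\varphi_r\colon V\to W$ be the linear map with $$\varphi_r(v_{ji})=\begin{cases} w_{jir} & \text{if } r\ge i,\\ w_{jri}-w_{irj} & \text{if } r<i.\end{cases}$$ Let $$X=\Bigl\{\sum_{i<j} a_{ji}v_{ji}\in V \ :\ \prod_{i<j}[x_j,x_i]^{a_{ji}}\in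 N\Bigr\},\qquad Y_X=\bigl\langle \varphi_1(X),\dots,\varphi_n(X)\bigr\rangle\subseteq W,\qquad Z_X=\bigcap_{i=1}^n\varphi_i^{-1}(Y_X)\subseteq V .$$ Then $G$ is capable (that is, $G\cong H/Z(H)$ for some group $H$) if and only if $X=Z_X$. -/

import Mathlib

universe u v

/-- A group `G` is capable if it is isomorphic to `H / Z(H)` for some group `H`. -/
def IsCapable (G : Type u) [Group G] : Prop :=
  ∃ (H : Type v) (_ : Group H), Nonempty (G ≃* H ⧸ Subgroup.center H)

/-- `g₁, …, gₙ` generate `G`, and no family of fewer than `n` elements generates `G`. -/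
def MinimallyGenerates {G : Type u} [Group G] {n : ℕ} (g : Fin n → G) : Prop :=
  Subgroup.closure (Set.range g) = ⊤ ∧
    ∀ m : ℕ, m < n → ∀ h : Fin m → G, Subgroup.closure (Set.range h) ≠ ⊤

/-- The term `F_{k+1}` of the lower central series of the free product `F` of the groups `A i`
(Mathlib's series starts with index `0` at the whole group). -/
abbrev freeProductLCS {ι : Type*} (A : ι → Type*) [∀ i, Group (A i)] (k : ℕ) :
    Subgroup (Monoid.CoprodI A) :=
  (⊤ : Subgroup (Monoid.CoprodI A)).lowerCentralSeries k

/-- The `k`-nilpotent product `F / F_{k+1}` of the groups `A i`, where `F` is their free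
product. -/
abbrev NilpotentProduct {ι : Type*} (A : ι → Type*) [∀ i, Group (A i)] (k : ℕ) : Type _ :=
  Monoid.CoprodI A ⧸ freeProductLCS A k

/-- The `2`-nilpotent product of `n` cyclic groups of order `p`. -/
abbrev TwoNilProd (p n : ℕ) : Type :=
  NilpotentProduct (fun _ : Fin n => Multiplicative (ZMod p)) 2

namespace TwoNilProd

/-- The generator `xᵢ` of the `i`-th cyclic factor. -/
def gen (p n : ℕ) (i : Fin n) : TwoNilProd p n :=
  QuotientGroup.mk (Monoid.CoprodI.of
    (M := fun _ : Fin n => Multiplicative (ZMod p)) (i := i) (Multiplicative.ofAdd 1))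

theorem gen_pow (p n : ℕ) (i : Fin n) : gen p n i ^ p = 1 := by
  unfold gen
  rw [← QuotientGroup.mk_pow, ← map_pow, ← ofAdd_nsmul]
  have h : Multiplicative.ofAdd (p • (1 : ZMod p)) = 1 := by simp
  rw [h, map_one]
  exact QuotientGroup.mk_one _

end TwoNilProd

/-- The commutator `[x, y] = x⁻¹ y⁻¹ x y`. -/
def rcomm {G : Type*} [Group G] (x y : G) : G := x⁻¹ * y⁻¹ * x * y

open scoped commutatorElement in
theorem rcomm_eq {G : Type*} [Group G] (x y : G) : rcomm x y = ⁅x⁻¹, y⁻¹⁆ := by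
  simp [rcomm, commutatorElement_def, mul_assoc]

open scoped commutatorElement in
theorem rcomm_mem_center {G : Type*} [Group G]
    (h : (⊤ : Subgroup G).lowerCentralSeries 2 = ⊥) (x y : G) :
    rcomm x y ∈ Subgroup.center G := by
  have h1 : rcomm x y ∈ (⊤ : Subgroup G).lowerCentralSeries 1 := by
    rw [rcomm_eq]
    exact Subgroup.commutator_mem_commutator (Subgroup.mem_top _) (Subgroup.mem_top _)
  rw [Subgroup.mem_center_iff]
  intro z
  have h2 : ⁅rcomm x y, z⁆ ∈ (⊤ : Subgroup G).lowerCentralSeries 2 :=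
    Subgroup.commutator_mem_commutator h1 (Subgroup.mem_top _)
  rw [h, Subgroup.mem_bot, commutatorElement_eq_one_iff_mul_comm] at h2
  exact h2.symm

theorem rcomm_pow {G : Type*} [Group G]
    (h : (⊤ : Subgroup G).lowerCentralSeries 2 = ⊥) (x y : G) (p : ℕ) (hx : x ^ p = 1) :
    rcomm x y ^ p = 1 := by
  have hc : Commute x (rcomm x y) := Subgroup.mem_center_iff.mp (rcomm_mem_center h x y) x
  have h1 : y⁻¹ * x * y = x * rcomm x y := by simp [rcomm, mul_assoc]
  have h2 : (y⁻¹ * x * y) ^ p = 1 := by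
    have := conj_pow (i := p) (a := y⁻¹) (b := x)
    rw [inv_inv] at this
    rw [this, hx]
    simp
  rwa [h1, hc.mul_pow, hx, one_mul] at h2

theorem TwoNilProd.lcs_eq_bot (p n : ℕ) :
    (⊤ : Subgroup (TwoNilProd p n)).lowerCentralSeries 2 = ⊥ := by
  have h := Subgroup.map_lowerCentralSeries (⊤ : Subgroup (Monoid.CoprodI
    (fun _ : Fin n => Multiplicative (ZMod p)))) (QuotientGroup.mk' (freeProductLCS
      (fun _ : Fin n => Multiplicative (ZMod p)) 2)) 2
  rw [Subgroup.map_top_of_surjective _ (QuotientGroup.mk'_surjective _)] at h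
  rw [← h, QuotientGroup.map_mk'_self]

section NaturalMap

variable {G : Type u} [Group G] {p n : ℕ} [NeZero p]

/-- The homomorphism from the cyclic group of order `p` sending its generator to `g`. -/
def cyclicLift (g : G) (hg : g ^ p = 1) : Multiplicative (ZMod p) →* G where
  toFun a := g ^ (Multiplicative.toAdd a).val
  map_one' := by simp
  map_mul' a b := by
    rw [toAdd_mul, ZMod.val_add, ← pow_add, ← pow_eq_pow_mod _ hg]

/-- The natural map from the `2`-nilpotent product of `n` cyclic groups of order `p` to a group
`G` of class at most `2`, induced by `xᵢ ↦ gᵢ`. -/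
def naturalMap (hG : (⊤ : Subgroup G).lowerCentralSeries 2 = ⊥) (g : Fin n → G)
    (hg : ∀ i, g i ^ p = 1) : TwoNilProd p n →* G :=
  QuotientGroup.lift _ (Monoid.CoprodI.lift fun i => cyclicLift (g i) (hg i)) (by
    rw [← Subgroup.map_eq_bot_iff, Subgroup.map_lowerCentralSeries, eq_bot_iff, ← hG]
    exact Subgroup.lowerCentralSeries_mono 2 le_top)

theorem naturalMap_gen (hG : (⊤ : Subgroup G).lowerCentralSeries 2 = ⊥) (g : Fin n → G)
    (hg : ∀ i, g i ^ p = 1) (i : Fin n) :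
    naturalMap hG g hg (TwoNilProd.gen p n i) = g i := by
  rw [naturalMap, TwoNilProd.gen, QuotientGroup.lift_mk, Monoid.CoprodI.lift_of]
  change g i ^ (1 : ZMod p).val = g i
  rw [ZMod.val_one_eq_one_mod, ← pow_eq_pow_mod _ (hg i), pow_one]

end NaturalMap

/-- Indices `(j, i)` with `i < j` of the standard basis of `V`. -/
abbrev VIndex (n : ℕ) : Type := {q : Fin n × Fin n // q.2 < q.1}

/-- Indices `(j, i, k)` with `i < j` and `i ≤ k` of the standard basis of `W`. -/
abbrev WIndex (n : ℕ) : Type := {q : Fin n × Fin n × Fin n // q.2.1 < q.1 ∧ q.2.1 ≤ q.2.2}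

/-- The vector space `V` over `𝔽_p` with basis `v_{ji}`, `i < j`. -/
abbrev VSpace (p n : ℕ) : Type := VIndex n →₀ ZMod p

/-- The vector space `W` over `𝔽_p` with basis `w_{jik}`, `i < j`, `i ≤ k`. -/
abbrev WSpace (p n : ℕ) : Type := WIndex n →₀ ZMod p

/-- The basis vector `w_{jik}` of `W`. -/
noncomputable def wBasis (p : ℕ) {n : ℕ} (j i k : Fin n) (h : i < j ∧ i ≤ k) : WSpace p n :=
  Finsupp.single ⟨(j, i, k), h⟩ 1

/-- The linear map `φ_r : V → W` with `φ_r(v_{ji}) = w_{jir}` if `i ≤ r`, and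
`φ_r(v_{ji}) = w_{jri} - w_{irj}` if `r < i`. -/
noncomputable def phi (p : ℕ) {n : ℕ} (r : Fin n) : VSpace p n →ₗ[ZMod p] WSpace p n :=
  Finsupp.linearCombination (ZMod p) fun q : VIndex n =>
    if h : q.1.2 ≤ r then
      wBasis p q.1.1 q.1.2 r ⟨q.2, h⟩
    else
      wBasis p q.1.1 r q.1.2 ⟨(not_le.mp h).trans q.2, (not_le.mp h).le⟩ -
        wBasis p q.1.2 r q.1.1 ⟨not_le.mp h, ((not_le.mp h).trans q.2).le⟩

/-- `Y_X = ⟨φ₁(X), …, φₙ(X)⟩`. -/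
noncomputable def spaceY {p n : ℕ} (X : Submodule (ZMod p) (VSpace p n)) :
    Submodule (ZMod p) (WSpace p n) :=
  ⨆ r : Fin n, X.map (phi p r)

/-- `Z_X = ⋂ φᵢ⁻¹(Y_X)`. -/
noncomputable def spaceZ {p n : ℕ} (X : Submodule (ZMod p) (VSpace p n)) :
    Submodule (ZMod p) (VSpace p n) :=
  ⨅ i : Fin n, (spaceY X).comap (phi p i)

namespace TwoNilProd

/-- The commutator `[x_j, x_i]` in the `2`-nilpotent product, as an element of its center. -/
def basicComm (p n : ℕ) (q : VIndex n) : Subgroup.center (TwoNilProd p n) :=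
  ⟨rcomm (gen p n q.1.1) (gen p n q.1.2), rcomm_mem_center (lcs_eq_bot p n) _ _⟩

theorem basicComm_pow (p n : ℕ) (q : VIndex n) : basicComm p n q ^ p = 1 :=
  Subtype.ext (rcomm_pow (lcs_eq_bot p n) _ _ p (gen_pow p n _))

open scoped IsMulCommutative in
/-- The element `∏_{i < j} [x_j, x_i]^{a_{ji}}` of the `2`-nilpotent product that corresponds to
the vector `∑ a_{ji} v_{ji}` of `V`; it is formed in the (commutative) center. -/
noncomputable def ofVector {p n : ℕ} (a : VSpace p n) : TwoNilProd p n :=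
  ((∏ q : VIndex n, basicComm p n q ^ (a q).val : Subgroup.center (TwoNilProd p n)) :
    TwoNilProd p n)

open scoped IsMulCommutative in
theorem ofVector_zero (p n : ℕ) : ofVector (0 : VSpace p n) = 1 := by
  simp [ofVector]

open scoped IsMulCommutative in
theorem ofVector_add {p n : ℕ} [NeZero p] (a b : VSpace p n) :
    ofVector (a + b) = ofVector a * ofVector b := by
  unfold ofVector
  rw [← Subgroup.coe_mul, ← Finset.prod_mul_distrib]
  congr 1
  refine Finset.prod_congr rfl fun q _ => ?_
  rw [Finsupp.add_apply, ZMod.val_add, ← pow_add, ← pow_eq_pow_mod _ (basicComm_pow p n q)]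

/-- The homomorphism `v_{ji} ↦ [x_j, x_i]` from `V` to the `2`-nilpotent product. -/
noncomputable def ofVectorHom (p n : ℕ) [NeZero p] :
    Multiplicative (VSpace p n) →* TwoNilProd p n where
  toFun a := ofVector (Multiplicative.toAdd a)
  map_one' := ofVector_zero p n
  map_mul' _ _ := ofVector_add _ _

end TwoNilProd

/-- The subspace `X` of `V` determined by a group `G` of class at most `2` and elements
`g₁, …, gₙ` of `G` with `gᵢ ^ p = 1`: the vectors `∑ a_{ji} v_{ji}` such that
`∏ [x_j, x_i]^{a_{ji}}` is in the kernel of the natural map `xᵢ ↦ gᵢ` from the `2`-nilpotent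
product of `n` cyclic groups of order `p` to `G`. -/
noncomputable def commRelSpace {G : Type u} [Group G] {p n : ℕ} [NeZero p]
    (hG : (⊤ : Subgroup G).lowerCentralSeries 2 = ⊥) (g : Fin n → G)
    (hg : ∀ i, g i ^ p = 1) : Submodule (ZMod p) (VSpace p n) :=
  AddSubgroup.toZModSubmodule p
    (Subgroup.toAddSubgroup' ((naturalMap hG g hg).ker.comap (TwoNilProd.ofVectorHom p n)))

theorem mem_commRelSpace {G : Type u} [Group G] {p n : ℕ} [NeZero p]
    (hG : (⊤ : Subgroup G).lowerCentralSeries 2 = ⊥) (g : Fin n → G)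
    (hg : ∀ i, g i ^ p = 1) (a : VSpace p n) :
    a ∈ commRelSpace hG g hg ↔ TwoNilProd.ofVector a ∈ (naturalMap hG g hg).ker :=
  Iff.rfl

/-! ### Commutator calculus in groups of class at most three -/

section Commutators

variable {G : Type*} [Group G]

/-! The maps `φ_r` record commutation with the `r`-th generator: `V` stands for commutators, `W` for
triple commutators on a basis, and the second case of `phi` is the Jacobi identity rewriting `[[x_j,
x_i], x_r]` for `r < i`.

Necessity (`commRelSpace_eq_spaceZ_of_mulEquiv`). If `G ≅ H / Z(H)`, then `H` has class at most
three. Lift `g_i` to `h_i`. The elements `[[h_j, h_i], h_k]` are central, are killed by `p` and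
satisfy Jacobi, so they define `ψ : W → Z(H)`, and `ψ (φ_r v)` is the commutator with `h_r` of any
lift of the image of `v` in `G`. For `v ∈ X` this lift is central, so `ψ` kills `Y_X`. For `v ∈ Z_X`
the lift therefore commutes with every `h_r`; these generate `H` modulo its center, so the lift is
central and `v ∈ X`.

Sufficiency (`isCapable_of_commRelSpace_eq_spaceZ`). The witness `H` is a group of elements `1 + a +
b + c` in the truncated tensor algebra, with `c` taken modulo the image of `Y_X`. Since `p` is odd,
forgetting `c` yields the 2-nilpotent product (`TruncGroup.fromTwoNilProd_bijective`), which maps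
onto `G`. Bracketing with `x_r` realizes `φ_r` (`lieMap_phi`), so the center of `H` consists of the
elements with `a = 0` and `b` in the image of `Z_X` (`TruncGroup.mem_center_iff`). By minimality of
the generators, the kernel of `H → G` is described in the same way with `X` in place of `Z_X`. If `X
= Z_X`, the kernel is the center. -/

theorem rcomm_self_mul (x y : G) : x * y = y * x * rcomm x y := by
  simp only [rcomm]; group

theorem rcomm_eq_one_iff (x y : G) : rcomm x y = 1 ↔ x * y = y * x := by
  rw [rcomm_self_mul x y]; simp

theorem map_rcomm {M : Type*} [Group M] (f : G →* M) (x y : G) :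
    f (rcomm x y) = rcomm (f x) (f y) := by
  simp [rcomm]

theorem rcomm_mul_left {x y z : G} (h : rcomm x z ∈ Subgroup.center G) :
    rcomm (x * y) z = rcomm x z * rcomm y z := by
  have h1 : rcomm (x * y) z = y⁻¹ * rcomm x z * y * rcomm y z := by
    simp only [rcomm]; group
  rw [h1, Subgroup.mem_center_iff.mp h y⁻¹]; group

theorem rcomm_mul_right {x y z : G} (h : rcomm x y ∈ Subgroup.center G) :
    rcomm x (y * z) = rcomm x y * rcomm x z := by
  have h1 : rcomm x (y * z) = rcomm x z * (z⁻¹ * rcomm x y * z) := by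
    simp only [rcomm]; group
  rw [h1, Subgroup.mem_center_iff.mp h z⁻¹, inv_mul_cancel_right,
    Subgroup.mem_center_iff.mp h]

theorem rcomm_of_mem_center_left {x : G} (h : x ∈ Subgroup.center G) (y : G) :
    rcomm x y = 1 :=
  (rcomm_eq_one_iff x y).mpr (Subgroup.mem_center_iff.mp h y).symm

theorem rcomm_of_mem_center_right {y : G} (h : y ∈ Subgroup.center G) (x : G) :
    rcomm x y = 1 :=
  (rcomm_eq_one_iff x y).mpr (Subgroup.mem_center_iff.mp h x)

theorem rcomm_swap (x y : G) : rcomm y x = (rcomm x y)⁻¹ := by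
  simp only [rcomm]; group

theorem rcomm_pow_right {x y : G} (h : ∀ z, rcomm x z ∈ Subgroup.center G) (m : ℕ) :
    rcomm x (y ^ m) = rcomm x y ^ m := by
  induction m with
  | zero => simp [rcomm]
  | succ m ih => rw [pow_succ, rcomm_mul_right (h _), ih, pow_succ]

theorem rcomm_inv_left {x y : G} (h : rcomm x y ∈ Subgroup.center G) :
    rcomm x⁻¹ y = (rcomm x y)⁻¹ := by
  have h1 := rcomm_mul_left (y := x⁻¹) h
  rw [mul_inv_cancel, rcomm_of_mem_center_left (one_mem _)] at h1
  exact (inv_eq_of_mul_eq_one_right h1.symm).symm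

/-- The Hall–Witt identity. -/
theorem rcomm_hall_witt (x y z : G) :
    (y⁻¹ * rcomm (rcomm x y⁻¹) z * y) * (z⁻¹ * rcomm (rcomm y z⁻¹) x * z) *
      (x⁻¹ * rcomm (rcomm z x⁻¹) y * x) = 1 := by
  simp only [rcomm]; group

/-- `[x, y⁻¹]` differs from `[x, y]⁻¹` by a triple commutator, which is central and so disappears in
the outer commutator. This removes the inverses from Hall–Witt. -/
theorem rcomm_rcomm_inv (hG : ∀ x y z : G, rcomm (rcomm x y) z ∈ Subgroup.center G)
    (x y z : G) : rcomm (rcomm x y⁻¹) z = (rcomm (rcomm x y) z)⁻¹ := by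
  have h1 : rcomm x y⁻¹ = (rcomm x y)⁻¹ * rcomm (rcomm x y)⁻¹ y⁻¹ := by
    simp only [rcomm]; group
  have h2 : rcomm (rcomm x y)⁻¹ y⁻¹ ∈ Subgroup.center G := by
    rw [← rcomm_swap]; exact hG _ _ _
  have h3 : rcomm (rcomm x y)⁻¹ z = (rcomm (rcomm x y) z)⁻¹ := rcomm_inv_left (hG _ _ _)
  rw [h1, rcomm_mul_left (by rw [h3]; exact inv_mem (hG _ _ _)), h3,
    rcomm_of_mem_center_left h2, mul_one]

/-- Hall–Witt with the conjugations dropped by centrality. The form is chosen to match `w_{jri} -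
w_{irj}` in the second case of `phi`. -/
theorem rcomm_jacobi (hG : ∀ x y z : G, rcomm (rcomm x y) z ∈ Subgroup.center G)
    (x y z : G) :
    rcomm (rcomm x y) z = rcomm (rcomm x z) y * (rcomm (rcomm y z) x)⁻¹ := by
  have hc : ∀ x y z w : G, w⁻¹ * (rcomm (rcomm x y) z)⁻¹ * w = (rcomm (rcomm x y) z)⁻¹ := by
    intro x y z w
    rw [Subgroup.mem_center_iff.mp (inv_mem (hG x y z)) w⁻¹]; group
  have h := rcomm_hall_witt x y z
  simp only [rcomm_rcomm_inv hG, hc] at h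
  rw [rcomm_swap x z, rcomm_inv_left (hG _ _ _), inv_inv] at h
  have h1 : rcomm (rcomm x z) y = rcomm (rcomm y z) x * rcomm (rcomm x y) z := by
    rw [mul_eq_one_iff_eq_inv] at h
    rw [← inv_inj, ← h]; group
  rw [h1, Subgroup.mem_center_iff.mp (hG x y z)]; group

end Commutators

/-! ### Homomorphisms out of the 2-nilpotent product and out of `V` and `W` -/

section NilpotentProducts

variable {p n : ℕ} [Fact p.Prime]

open scoped IsMulCommutative in
theorem ofVector_single (q : VIndex n) :
    TwoNilProd.ofVector (Finsupp.single q (1 : ZMod p)) =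
      rcomm (TwoNilProd.gen p n q.1.1) (TwoNilProd.gen p n q.1.2) := by
  classical
  have h : (1 : ZMod p).val = 1 := by
    rw [ZMod.val_one_eq_one_mod, Nat.mod_eq_of_lt (Fact.out : p.Prime).one_lt]
  unfold TwoNilProd.ofVector
  rw [Finset.prod_eq_single q]
  · simp [h, TwoNilProd.basicComm]
  · intro b _ hb
    rw [Finsupp.single_apply, if_neg hb.symm]; simp
  · simp

theorem monoidHom_finsupp_ext {ι M : Type*} [Monoid M]
    {f g : Multiplicative (ι →₀ ZMod p) →* M}
    (h : ∀ q, f (Multiplicative.ofAdd (Finsupp.single q 1)) =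
      g (Multiplicative.ofAdd (Finsupp.single q 1))) : f = g := by
  apply MonoidHom.toAdditiveRight.injective
  apply Finsupp.addHom_ext
  intro q a
  have : Finsupp.single q a = a.val • Finsupp.single q (1 : ZMod p) := by
    rw [Finsupp.smul_single]; simp
  rw [this, map_nsmul, map_nsmul]
  congr 1
  exact congrArg Additive.ofMul (h q)

theorem twoNilProd_hom_ext {M : Type*} [Monoid M] {f g : TwoNilProd p n →* M}
    (h : ∀ i, f (TwoNilProd.gen p n i) = g (TwoNilProd.gen p n i)) : f = g := by
  apply QuotientGroup.monoidHom_ext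
  apply Monoid.CoprodI.ext_hom
  intro i
  refine MonoidHom.ext fun a => ?_
  have h1 : a = (Multiplicative.ofAdd (1 : ZMod p)) ^ (Multiplicative.toAdd a).val := by
    rw [← ofAdd_nsmul]; simp
  rw [h1, map_pow, map_pow]
  congr 1
  exact h i

theorem naturalMap_surjective {G : Type*} [Group G]
    (hG : (⊤ : Subgroup G).lowerCentralSeries 2 = ⊥) (g : Fin n → G)
    (hg : ∀ i, g i ^ p = 1) (h : Subgroup.closure (Set.range g) = ⊤) :
    Function.Surjective (naturalMap hG g hg) := by
  rw [← MonoidHom.range_eq_top, eq_top_iff, ← h, Subgroup.closure_le]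
  rintro _ ⟨i, rfl⟩
  exact ⟨_, naturalMap_gen hG g hg i⟩

/-- The homomorphism from the group `(ι →₀ 𝔽_p, +)` sending the basis vector at `q` to `t q`. -/
noncomputable def finsuppLift {ι M : Type*} [CommGroup M] (t : ι → M) (ht : ∀ q, t q ^ p = 1) :
    Multiplicative (ι →₀ ZMod p) →* M :=
  AddMonoidHom.toMultiplicativeLeft (Finsupp.liftAddHom fun q =>
    ZMod.lift p ⟨zmultiplesHom (Additive M) (Additive.ofMul (t q)), by
      simp [← ofMul_pow, ht]⟩)

theorem finsuppLift_single {ι M : Type*} [CommGroup M] (t : ι → M) (ht : ∀ q, t q ^ p = 1)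
    (q : ι) : finsuppLift t ht (Multiplicative.ofAdd (Finsupp.single q 1)) = t q := by
  have h : ZMod.lift p ⟨zmultiplesHom (Additive M) (Additive.ofMul (t q)), by
      simp [← ofMul_pow, ht]⟩ (1 : ZMod p) = Additive.ofMul (t q) := by
    have := ZMod.lift_coe p ⟨zmultiplesHom (Additive M) (Additive.ofMul (t q)), by
      simp [← ofMul_pow, ht]⟩ 1
    simpa using this
  simp [finsuppLift, h]

theorem phi_single_of_le {r : Fin n} {q : VIndex n} (h : q.1.2 ≤ r) :
    phi p r (Finsupp.single q 1) = wBasis p q.1.1 q.1.2 r ⟨q.2, h⟩ := by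
  simp [phi, h]

theorem phi_single_of_lt {r : Fin n} {q : VIndex n} (h : r < q.1.2) :
    phi p r (Finsupp.single q 1) =
      wBasis p q.1.1 r q.1.2 ⟨h.trans q.2, h.le⟩ -
        wBasis p q.1.2 r q.1.1 ⟨h, (h.trans q.2).le⟩ := by
  simp [phi, not_le.mpr h]

theorem le_spaceZ (X : Submodule (ZMod p) (VSpace p n)) : X ≤ spaceZ X := by
  refine le_iInf fun i => ?_
  rw [← Submodule.map_le_iff_le_comap]
  exact le_iSup (fun r => X.map (phi p r)) i

end NilpotentProducts

/-! ### Necessity: a capable group satisfies `X = Z_X` -/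

section Necessity

variable {p n : ℕ} [Fact p.Prime] {G : Type u} [Group G] {H : Type v} [Group H]

theorem commRelSpace_eq_spaceZ_of_mulEquiv
    (hclass : (⊤ : Subgroup G).lowerCentralSeries 2 = ⊥) (g : Fin n → G)
    (hg : ∀ i, g i ^ p = 1) (hgen : Subgroup.closure (Set.range g) = ⊤)
    (hexp : ∀ x : G, x ^ p = 1) (e : G ≃* H ⧸ Subgroup.center H) :
    commRelSpace hclass g hg = spaceZ (commRelSpace hclass g hg) := by
  refine le_antisymm (le_spaceZ _) ?_
  set X := commRelSpace hclass g hg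
  let π := QuotientGroup.mk' (Subgroup.center H)
  have hπ : ∀ d, π d = 1 ↔ d ∈ Subgroup.center H := QuotientGroup.eq_one_iff
  have hπ2 : ∀ d d', π d = π d' → ∃ z ∈ Subgroup.center H, d' = d * z := by
    intro d d' h
    exact ⟨d⁻¹ * d', QuotientGroup.eq.mp h, by group⟩
  -- A set-theoretic section is enough: changing a lift by a central factor does not change its
  -- commutators.
  choose σ hσ using fun x : G => QuotientGroup.mk'_surjective (Subgroup.center H) (e x)
  have hσ' : ∀ x, π (σ x) = e x := hσ
  set h : Fin n → H := fun i => σ (g i)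
  have hpow : ∀ d : H, d ^ p ∈ Subgroup.center H := by
    intro d
    obtain ⟨x, hx⟩ := e.surjective (π d)
    rw [← hπ, map_pow, ← hx, ← map_pow, hexp, map_one]
  -- elements of `H` over the center of `G` have central commutators
  have hcen : ∀ x ∈ Subgroup.center G, ∀ d : H, π d = e x → ∀ y,
      rcomm d y ∈ Subgroup.center H := by
    intro x hx d hd y
    obtain ⟨y', hy'⟩ := e.surjective (π y)
    rw [← hπ, map_rcomm, hd, ← hy']
    refine (map_rcomm e.toMonoidHom x y').symm.trans ?_
    rw [rcomm_of_mem_center_left hx, map_one]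
  have hH : ∀ x y z : H, rcomm (rcomm x y) z ∈ Subgroup.center H := by
    intro x y z
    obtain ⟨x', hx'⟩ := e.surjective (π x)
    obtain ⟨y', hy'⟩ := e.surjective (π y)
    refine hcen _ (rcomm_mem_center hclass x' y') _ ?_ z
    rw [map_rcomm, ← hx', ← hy']
    exact (map_rcomm e.toMonoidHom x' y').symm
  let κ : Multiplicative (VSpace p n) →* G :=
    (naturalMap hclass g hg).comp (TwoNilProd.ofVectorHom p n)
  have hX : ∀ v : VSpace p n, v ∈ X ↔ κ (Multiplicative.ofAdd v) = 1 := fun v => Iff.rfl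
  have hκ1 : ∀ q : VIndex n, κ (Multiplicative.ofAdd (Finsupp.single q 1)) =
      rcomm (g q.1.1) (g q.1.2) := by
    intro q
    change naturalMap hclass g hg (TwoNilProd.ofVector (Finsupp.single q 1)) = _
    rw [ofVector_single, map_rcomm, naturalMap_gen, naturalMap_gen]
  have hκ : ∀ v, κ v ∈ Subgroup.center G := by
    intro v
    rw [Subgroup.mem_center_iff]
    intro y
    obtain ⟨y, rfl⟩ := naturalMap_surjective hclass g hg hgen y
    have : TwoNilProd.ofVectorHom p n v ∈ Subgroup.center (TwoNilProd p n) :=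
      SetLike.coe_mem _
    change _ * naturalMap hclass g hg _ = naturalMap hclass g hg _ * _
    rw [← map_mul, ← map_mul, Subgroup.mem_center_iff.mp this]
  open scoped IsMulCommutative in
  let t : Fin n → Fin n → Fin n → Subgroup.center H := fun j i k =>
    ⟨rcomm (rcomm (h j) (h i)) (h k), hH _ _ _⟩
  have ht : ∀ j i k, t j i k ^ p = 1 := by
    intro j i k
    apply Subtype.ext
    change rcomm (rcomm (h j) (h i)) (h k) ^ p = 1
    -- `[c, h_k]^p = [c, h_k^p] = 1`, because `p`-th powers in `H` are central.
    rw [← rcomm_pow_right (hH _ _), rcomm_of_mem_center_right (hpow _)]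
  have htj : ∀ j i k, t j i k = t j k i * (t i k j)⁻¹ := by
    intro j i k
    exact Subtype.ext (rcomm_jacobi hH (h j) (h i) (h k))
  open scoped IsMulCommutative in
  let ψ : Multiplicative (WSpace p n) →* Subgroup.center H :=
    finsuppLift (fun q : WIndex n => t q.1.1 q.1.2.1 q.1.2.2) (fun q => ht _ _ _)
  open scoped IsMulCommutative in
  have hψ : ∀ j i k hh, ψ (Multiplicative.ofAdd (wBasis p j i k hh)) = t j i k := by
    intro j i k hh
    exact finsuppLift_single _ _ _
  -- Commutation with `h_r` on lifts of `κ v`. It is multiplicative because these commutators are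
  -- central, although `σ` itself need not be.
  let B : Fin n → Multiplicative (VSpace p n) →* Subgroup.center H := fun r =>
    { toFun := fun v => ⟨rcomm (σ (κ v)) (h r), hcen _ (hκ v) _ (hσ' _) _⟩
      map_one' := by
        apply Subtype.ext
        refine rcomm_of_mem_center_left ?_ _
        rw [← hπ, hσ', map_one, map_one]
      map_mul' := by
        intro v w
        apply Subtype.ext
        change rcomm (σ (κ (v * w))) (h r) = rcomm (σ (κ v)) (h r) * rcomm (σ (κ w)) (h r)
        obtain ⟨z, hz, hz'⟩ := hπ2 (σ (κ v) * σ (κ w)) (σ (κ (v * w))) (by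
          rw [map_mul, hσ', hσ', hσ', map_mul, map_mul])
        rw [hz', mul_assoc, rcomm_mul_left (hcen _ (hκ v) _ (hσ' _) _),
          rcomm_mul_left (hcen _ (hκ w) _ (hσ' _) _), rcomm_of_mem_center_left hz, mul_one] }
  have hB1 : ∀ r (q : VIndex n), B r (Multiplicative.ofAdd (Finsupp.single q 1)) =
      t q.1.1 q.1.2 r := by
    intro r q
    apply Subtype.ext
    change rcomm (σ (κ _)) (h r) = rcomm (rcomm (h q.1.1) (h q.1.2)) (h r)
    obtain ⟨z, hz, hz'⟩ := hπ2 (rcomm (h q.1.1) (h q.1.2))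
      (σ (κ (Multiplicative.ofAdd (Finsupp.single q 1)))) (by
        rw [hσ', hκ1, map_rcomm, hσ', hσ']
        exact (map_rcomm e.toMonoidHom _ _).symm)
    rw [hz', rcomm_mul_left (hH _ _ _), rcomm_of_mem_center_left hz, mul_one]
  have hBψ : ∀ r (v : VSpace p n), ψ (Multiplicative.ofAdd (phi p r v)) =
      B r (Multiplicative.ofAdd v) := by
    intro r v
    have : ψ.comp (AddMonoidHom.toMultiplicative (phi p r).toAddMonoidHom) = B r := by
      apply monoidHom_finsupp_ext
      intro q
      rw [hB1]
      change ψ (Multiplicative.ofAdd (phi p r (Finsupp.single q 1))) = _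
      rcases le_or_gt q.1.2 r with hr | hr
      · rw [phi_single_of_le hr, hψ]
      · rw [phi_single_of_lt hr, ofAdd_sub, map_div, hψ, hψ, htj q.1.1 q.1.2 r, div_eq_mul_inv]
    rw [← this]; rfl
  let K : Submodule (ZMod p) (WSpace p n) :=
    AddSubgroup.toZModSubmodule p (Subgroup.toAddSubgroup' ψ.ker)
  have hK : ∀ w, w ∈ K ↔ ψ (Multiplicative.ofAdd w) = 1 := fun w => Iff.rfl
  have hY : spaceY X ≤ K := by
    refine iSup_le fun r => ?_
    rw [Submodule.map_le_iff_le_comap]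
    intro v hv
    rw [Submodule.mem_comap, hK, hBψ]
    apply Subtype.ext
    refine rcomm_of_mem_center_left ?_ _
    rw [← hπ, hσ', (hX v).mp hv, map_one]
  intro v hv
  rw [hX]
  set d := σ (κ (Multiplicative.ofAdd v))
  have hd : ∀ r, d * h r = h r * d := by
    intro r
    have h1 : phi p r v ∈ spaceY X := (Submodule.mem_iInf _).mp hv r
    have h2 := (hK _).mp (hY h1)
    rw [hBψ] at h2
    exact (rcomm_eq_one_iff _ _).mp (congrArg Subtype.val h2)
  -- The centralizer of `d` contains every `h_r`, hence covers `H / Z(H)`; it also contains the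
  -- center, so it is all of `H`.
  have hC : (Subgroup.centralizer {d}).map π = ⊤ := by
    rw [eq_top_iff, ← Subgroup.map_top_of_surjective e.toMonoidHom e.surjective, ← hgen,
      MonoidHom.map_closure, Subgroup.closure_le]
    rintro _ ⟨_, ⟨r, rfl⟩, rfl⟩
    exact ⟨h r, Subgroup.mem_centralizer_singleton_iff.mpr (hd r).symm, hσ' _⟩
  have hdc : d ∈ Subgroup.center H := by
    rw [Subgroup.mem_center_iff]
    intro y
    have : π y ∈ (Subgroup.centralizer {d}).map π := hC ▸ Subgroup.mem_top _
    obtain ⟨c, hc, hcy⟩ := this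
    obtain ⟨z, hz, rfl⟩ := hπ2 _ _ hcy
    have hc' := Subgroup.mem_centralizer_singleton_iff.mp hc
    have hz' := Subgroup.mem_center_iff.mp hz d
    rw [mul_assoc, ← hz', ← mul_assoc, hc', mul_assoc]
  rw [← hπ, hσ'] at hdc
  exact e.injective (hdc.trans (map_one e).symm)

end Necessity

/-! ### The group of truncated tensors -/

section TruncatedTensors

variable {p n : ℕ}

/-- Degree two tensors over `𝔽_p ^ n`, given by their coordinates. -/
abbrev TensorTwo (p n : ℕ) : Type := Fin n → Fin n → ZMod p

/-- Degree three tensors over `𝔽_p ^ n`, given by their coordinates. -/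
abbrev TensorThree (p n : ℕ) : Type := Fin n → Fin n → Fin n → ZMod p

/-- The product of a vector and a degree two tensor. -/
def tensorLeft (a : Fin n → ZMod p) (b : TensorTwo p n) : TensorThree p n :=
  fun x y z => a x * b y z

/-- The product of a degree two tensor and a vector. -/
def tensorRight (b : TensorTwo p n) (a : Fin n → ZMod p) : TensorThree p n :=
  fun x y z => b x y * a z

/-- The group of units `1 + a + b + c` of the tensor algebra truncated above degree three, whose
degree two part `b` has symmetrization `a ⊗ a`, with degree three part taken modulo `Y`. -/
@[ext]
structure TruncGroup (Y : Submodule (ZMod p) (TensorThree p n)) where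
  one : Fin n → ZMod p
  two : TensorTwo p n
  three : TensorThree p n ⧸ Y
  symm_two : ∀ i j, two i j + two j i = one i * one j

namespace TruncGroup

variable (Y : Submodule (ZMod p) (TensorThree p n))

instance : Mul (TruncGroup Y) where
  mul x y :=
    { one := x.one + y.one
      two := fun i j => x.two i j + y.two i j + x.one i * y.one j
      three := x.three + y.three + Y.mkQ (tensorLeft x.one y.two + tensorRight x.two y.one)
      symm_two := fun i j => by
        simp only [Pi.add_apply]
        linear_combination x.symm_two i j + y.symm_two i j }

instance : One (TruncGroup Y) where
  one := { one := 0, two := 0, three := 0, symm_two := fun i j => by simp }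

instance : Inv (TruncGroup Y) where
  inv x :=
    { one := -x.one
      two := fun i j => x.one i * x.one j - x.two i j
      three := -x.three + Y.mkQ (tensorLeft x.one x.two + tensorRight x.two x.one -
        tensorLeft x.one fun i j => x.one i * x.one j)
      symm_two := fun i j => by
        simp only [Pi.neg_apply]
        linear_combination -x.symm_two i j }

variable {Y}

@[simp] theorem mul_one' (x y : TruncGroup Y) : (x * y).one = x.one + y.one := rfl
theorem mul_two (x y : TruncGroup Y) :
    (x * y).two = fun i j => x.two i j + y.two i j + x.one i * y.one j := rfl
theorem mul_three (x y : TruncGroup Y) : (x * y).three =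
    x.three + y.three + Y.mkQ (tensorLeft x.one y.two + tensorRight x.two y.one) := rfl
@[simp] theorem one_one : (1 : TruncGroup Y).one = 0 := rfl
@[simp] theorem one_two : (1 : TruncGroup Y).two = 0 := rfl
@[simp] theorem one_three : (1 : TruncGroup Y).three = 0 := rfl
theorem inv_one' (x : TruncGroup Y) : (x⁻¹).one = -x.one := rfl
theorem inv_two (x : TruncGroup Y) :
    (x⁻¹).two = fun i j => x.one i * x.one j - x.two i j := rfl
theorem inv_three (x : TruncGroup Y) : (x⁻¹).three =
    -x.three + Y.mkQ (tensorLeft x.one x.two + tensorRight x.two x.one -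
        tensorLeft x.one fun i j => x.one i * x.one j) := rfl

theorem mul_assoc' (x y z : TruncGroup Y) : x * y * z = x * (y * z) := by
  apply TruncGroup.ext
  · simp only [mul_one', add_assoc]
  · funext i j
    simp only [mul_two, mul_one', Pi.add_apply]
    ring
  · simp only [mul_three, mul_one']
    have h : tensorLeft x.one y.two + tensorRight x.two y.one +
        (tensorLeft (x.one + y.one) z.two + tensorRight (x * y).two z.one) =
        (tensorLeft y.one z.two + tensorRight y.two z.one) +
        (tensorLeft x.one (y * z).two + tensorRight x.two (y.one + z.one)) := by
      funext i j k
      simp only [mul_two, tensorLeft, tensorRight, Pi.add_apply]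
      ring
    have h2 := congrArg Y.mkQ h
    rw [map_add, map_add (Y.mkQ) (tensorLeft y.one z.two + tensorRight y.two z.one)] at h2
    calc _ = x.three + y.three + z.three + (Y.mkQ (tensorLeft x.one y.two +
          tensorRight x.two y.one) + Y.mkQ (tensorLeft (x.one + y.one) z.two +
          tensorRight (x * y).two z.one)) := by abel
      _ = _ := by rw [h2]; abel

instance : Group (TruncGroup Y) :=
  Group.ofLeftAxioms mul_assoc'
    (fun x => by
      apply TruncGroup.ext
      · simp
      · funext i j; simp [mul_two]
      · have : tensorLeft 0 x.two + tensorRight 0 x.one = 0 := by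
          funext i j k; simp [tensorLeft, tensorRight]
        simp [mul_three, this])
    (fun x => by
      apply TruncGroup.ext
      · simp [inv_one']
      · funext i j; simp [mul_two, inv_one', inv_two]
      · simp only [mul_three, inv_one', inv_two, inv_three, one_three]
        have h : (tensorLeft x.one x.two + tensorRight x.two x.one -
            tensorLeft x.one fun i j => x.one i * x.one j) +
            (tensorLeft (-x.one) x.two +
              tensorRight (fun i j => x.one i * x.one j - x.two i j) x.one) = 0 := by
          funext i j k
          simp only [tensorLeft, tensorRight, Pi.add_apply, Pi.sub_apply, Pi.neg_apply,
            Pi.zero_apply]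
          ring
        have h2 := congrArg Y.mkQ h
        rw [map_add, map_zero] at h2
        rw [← h2]
        abel)

/-- The degree one parts always commute, so only degrees two and three give conditions. -/
theorem mul_comm_iff (x y : TruncGroup Y) : x * y = y * x ↔
    (∀ i j, x.one i * y.one j = y.one i * x.one j) ∧
      tensorLeft x.one y.two + tensorRight x.two y.one -
        (tensorLeft y.one x.two + tensorRight y.two x.one) ∈ Y := by
  have hker : ∀ t, t ∈ Y ↔ Y.mkQ t = 0 := fun t => by rw [← LinearMap.mem_ker, Y.ker_mkQ]
  rw [TruncGroup.ext_iff, mul_three, mul_three, mul_two, mul_two, hker, map_sub, sub_eq_zero]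
  constructor
  · rintro ⟨-, h2, h3⟩
    refine ⟨fun i j => ?_, ?_⟩
    · have := congrFun (congrFun h2 i) j
      linear_combination this
    · rw [add_comm y.three] at h3
      exact add_left_cancel h3
  · rintro ⟨h2, h3⟩
    refine ⟨add_comm _ _, ?_, ?_⟩
    · funext i j
      linear_combination h2 i j
    · rw [add_comm y.three, h3]

/-- The projection to degree one. -/
def oneHom (Y : Submodule (ZMod p) (TensorThree p n)) :
    TruncGroup Y →* Multiplicative (Fin n → ZMod p) where
  toFun x := Multiplicative.ofAdd x.one
  map_one' := rfl
  map_mul' _ _ := rfl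

/-- The projection that forgets the degree three part. -/
def projTop (Y : Submodule (ZMod p) (TensorThree p n)) :
    TruncGroup Y →* TruncGroup (⊤ : Submodule (ZMod p) (TensorThree p n)) where
  toFun x := { x with three := 0 }
  map_one' := rfl
  map_mul' _ _ := TruncGroup.ext rfl rfl (Subsingleton.elim _ _)

theorem projTop_surjective : Function.Surjective (projTop Y) := fun x =>
  ⟨⟨x.one, x.two, 0, x.symm_two⟩, TruncGroup.ext rfl rfl (Subsingleton.elim _ _)⟩

/-- For `Y = ⊤` the degree three component lies in a zero module, so `TruncGroup ⊤` is the
truncation above degree two. It serves as a model of the 2-nilpotent product. -/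
theorem ext_top {x y : TruncGroup (⊤ : Submodule (ZMod p) (TensorThree p n))}
    (h1 : x.one = y.one) (h2 : x.two = y.two) : x = y :=
  TruncGroup.ext h1 h2 (Subsingleton.elim _ _)

theorem mem_center_of_one_eq_zero
    {x : TruncGroup (⊤ : Submodule (ZMod p) (TensorThree p n))} (h : x.one = 0) :
    x ∈ Subgroup.center _ := by
  rw [Subgroup.mem_center_iff]
  intro y
  rw [mul_comm_iff]
  simp [h]

theorem lowerCentralSeries_two :
    (⊤ : Subgroup (TruncGroup (⊤ : Submodule (ZMod p) (TensorThree p n)))).lowerCentralSeries 2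
      = ⊥ := by
  rw [eq_bot_iff]
  refine Subgroup.commutator_le.mpr fun x hx y _ => ?_
  rw [Subgroup.mem_bot, commutatorElement_eq_one_iff_mul_comm]
  have h1 : x.one = 0 := by
    have hle := Subgroup.lowerCentralSeries_mono 1 (le_top : (⊤ : Subgroup (TruncGroup
      (⊤ : Submodule (ZMod p) (TensorThree p n)))).map (oneHom ⊤) ≤ ⊤)
    have hx' := Subgroup.mem_map_of_mem (oneHom ⊤) hx
    rw [Subgroup.map_lowerCentralSeries] at hx'
    have hab : (⊤ : Subgroup (Multiplicative (Fin n → ZMod p))).lowerCentralSeries 1 ≤ ⊥ :=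
      Subgroup.commutator_le.mpr fun a _ b _ =>
        commutatorElement_eq_one_iff_mul_comm.mpr (mul_comm a b)
    exact hab (hle hx')
  exact (Subgroup.mem_center_iff.mp (mem_center_of_one_eq_zero h1) y).symm

/-- The element `1 + x_i + x_i ^ 2 / 2`. -/
noncomputable def gen (hp : (2 : ZMod p) * 2⁻¹ = 1) (Y : Submodule (ZMod p) (TensorThree p n))
    (i : Fin n) : TruncGroup Y where
  one := Pi.single i 1
  two := fun j k => 2⁻¹ * (Pi.single (M := fun _ => ZMod p) i 1 j *
    Pi.single (M := fun _ => ZMod p) i 1 k)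
  three := 0
  symm_two := fun j k => by
    linear_combination (Pi.single (M := fun _ => ZMod p) i 1 j *
      Pi.single (M := fun _ => ZMod p) i 1 k) * hp

theorem pow_one' (x : TruncGroup Y) (m : ℕ) : (x ^ m).one = m • x.one := by
  have := congrArg Multiplicative.toAdd (map_pow (oneHom Y) x m)
  simpa [oneHom] using this

/-- The degree two part of `(1 + a + b + c)^m` is `m b + (m choose 2) a ⊗ a`, doubled here to avoid
the division in the binomial coefficient. -/
theorem pow_two' (x : TruncGroup Y) (m : ℕ) (i j : Fin n) :
    2 * (x ^ m).two i j = 2 * m * x.two i j + m * (m - 1) * (x.one i * x.one j) := by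
  induction m with
  | zero => simp
  | succ m ih =>
    rw [pow_succ, mul_two, pow_one']
    simp only [Pi.smul_apply, nsmul_eq_mul]
    push_cast
    linear_combination ih

theorem gen_pow (hp : (2 : ZMod p) * 2⁻¹ = 1) (i : Fin n) :
    gen hp (⊤ : Submodule (ZMod p) (TensorThree p n)) i ^ p = 1 := by
  apply ext_top
  · funext j; simp [pow_one']
  · funext j k
    have h := pow_two' (gen hp (⊤ : Submodule (ZMod p) (TensorThree p n)) i) p j k
    simp only [CharP.cast_eq_zero, mul_zero, zero_mul, add_zero] at h
    simp only [one_two, Pi.zero_apply]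
    linear_combination 2⁻¹ * h - ((gen hp ⊤ i ^ p).two j k) * hp

end TruncGroup

/-! ### `V` and `W` inside the tensor algebra -/

/-- The embedding of `V` as the antisymmetric tensors of degree two. -/
def altMap (p n : ℕ) : VSpace p n →ₗ[ZMod p] TensorTwo p n where
  toFun v i j := if h : j < i then v ⟨(i, j), h⟩ else if h : i < j then -v ⟨(j, i), h⟩ else 0
  map_add' v w := by
    funext i j
    simp only [Finsupp.add_apply, Pi.add_apply]
    split_ifs <;> ring
  map_smul' c v := by
    funext i j
    simp only [Finsupp.smul_apply, Pi.smul_apply, smul_eq_mul, RingHom.id_apply]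
    split_ifs <;> ring

theorem altMap_injective : Function.Injective (altMap p n) := by
  intro v w h
  ext ⟨⟨i, j⟩, hq⟩
  have := congrFun (congrFun h i) j
  simpa [altMap, hq] using this

theorem altMap_antisymm (v : VSpace p n) (i j : Fin n) :
    altMap p n v i j + altMap p n v j i = 0 := by
  simp only [altMap, LinearMap.coe_mk, AddHom.coe_mk]
  rcases lt_trichotomy i j with h | h | h
  · simp [h, h.not_gt]
  · subst h; simp
  · simp [h, h.not_gt]

theorem exists_altMap (hp : (2 : ZMod p) * 2⁻¹ = 1) (b : TensorTwo p n)
    (hb : ∀ i j, b i j + b j i = 0) : ∃ v, altMap p n v = b := by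
  refine ⟨Finsupp.equivFunOnFinite.symm fun q => b q.1.1 q.1.2, ?_⟩
  funext i j
  simp only [altMap, LinearMap.coe_mk, AddHom.coe_mk, Finsupp.equivFunOnFinite_symm_apply_apply]
  split_ifs with h h'
  · rfl
  · linear_combination -hb i j
  -- On the diagonal, antisymmetry gives `2 b_ii = 0`.
  · obtain rfl : i = j := le_antisymm (not_lt.mp h) (not_lt.mp h')
    linear_combination (-2⁻¹) * hb i i + b i i * hp

/-- The coordinate tensor `x_i ⊗ x_j`. -/
def unitTwo (p : ℕ) {n : ℕ} (i j : Fin n) : TensorTwo p n :=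
  fun x y => Pi.single (M := fun _ => ZMod p) i 1 x * Pi.single (M := fun _ => ZMod p) j 1 y

theorem altMap_single (q : VIndex n) :
    altMap p n (Finsupp.single q 1) = unitTwo p q.1.1 q.1.2 - unitTwo p q.1.2 q.1.1 := by
  obtain ⟨⟨i, j⟩, hq⟩ := q
  simp only at hq
  funext x y
  simp only [altMap, LinearMap.coe_mk, AddHom.coe_mk, unitTwo, Pi.sub_apply, Pi.single_apply,
    Finsupp.single_apply, Subtype.mk.injEq, Prod.mk.injEq]
  split_ifs <;> first | (exfalso; omega) | simp

/-- The commutator `b ⊗ a - a ⊗ b` of a degree two tensor and a vector. -/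
def bracket (b : TensorTwo p n) : (Fin n → ZMod p) →ₗ[ZMod p] TensorThree p n where
  toFun a := tensorRight b a - tensorLeft a b
  map_add' a a' := by
    funext x y z; simp only [tensorLeft, tensorRight, Pi.add_apply, Pi.sub_apply]; ring
  map_smul' c a := by
    funext x y z
    simp only [tensorLeft, tensorRight, Pi.smul_apply, Pi.sub_apply, smul_eq_mul,
      RingHom.id_apply]
    ring

/-- The Lie monomial `[[x_j, x_i], x_k]` as a tensor. -/
def lieMonomial (p : ℕ) {n : ℕ} (j i k : Fin n) : TensorThree p n :=
  bracket (unitTwo p j i - unitTwo p i j) (Pi.single k 1)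

theorem lieMonomial_jacobi (j i k : Fin n) :
    lieMonomial p j i k = lieMonomial p j k i - lieMonomial p i k j := by
  funext x y z
  simp only [lieMonomial, bracket, LinearMap.coe_mk, AddHom.coe_mk, tensorLeft, tensorRight,
    unitTwo, Pi.sub_apply]
  ring

/-- The embedding of `W` as the Lie elements of degree three. -/
noncomputable def lieMap (p n : ℕ) : WSpace p n →ₗ[ZMod p] TensorThree p n :=
  Finsupp.linearCombination (ZMod p) fun q : WIndex n => lieMonomial p q.1.1 q.1.2.1 q.1.2.2

theorem lieMap_wBasis (j i k : Fin n) (h : i < j ∧ i ≤ k) :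
    lieMap p n (wBasis p j i k h) = lieMonomial p j i k := by
  simp [lieMap, wBasis]

/-- The word `x_i x_j x_k` has coefficient `-1` in `[[x_j, x_i], x_k]`, or `-2` if `k = i`, when
`x_k x_j x_i` is the same word. The conditions `i < j` and `i ≤ k` keep it out of all other basis
monomials, so each coordinate of `w` can be read off once `2` is invertible. -/
theorem lieMap_apply (w : WSpace p n) (j i k : Fin n) (h : i < j ∧ i ≤ k) :
    lieMap p n w i j k = -(if k = i then 2 else 1) * w ⟨(j, i, k), h⟩ := by
  induction w using Finsupp.induction_linear with
  | zero => simp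
  | add v w hv hw =>
    rw [map_add, Pi.add_apply, Pi.add_apply, Pi.add_apply, hv, hw, Finsupp.add_apply]; ring
  | single q c =>
    obtain ⟨⟨j', i', k'⟩, hq⟩ := q
    simp only at hq
    simp only [lieMap, Finsupp.linearCombination_single, Pi.smul_apply, smul_eq_mul, lieMonomial,
      bracket, LinearMap.coe_mk, AddHom.coe_mk, tensorLeft, tensorRight, unitTwo, Pi.sub_apply,
      Pi.single_apply, Finsupp.single_apply, Subtype.mk.injEq, Prod.mk.injEq]
    by_cases h1 : j' = j ∧ i' = i ∧ k' = k
    · obtain ⟨rfl, rfl, rfl⟩ := h1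
      have hne : i' ≠ j' := hq.1.ne
      by_cases h2 : k' = i'
      · subst h2; simp [hne, hne.symm]; ring
      · simp [hne, hne.symm, h2, Ne.symm h2]
    · rw [if_neg h1, mul_zero]
      have e1 : ¬(i = j' ∧ j = i') := by omega
      have e2 : ¬(i = i' ∧ j = j' ∧ k = k') := by omega
      have e3 : ¬(i = k' ∧ j = j' ∧ k = i') := by omega
      have e4 : ¬(i = k' ∧ j = i') := by omega
      split_ifs <;> first | (exfalso; omega) | simp

theorem lieMap_injective (hp : (2 : ZMod p) * 2⁻¹ = 1) : Function.Injective (lieMap p n) := by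
  rw [injective_iff_map_eq_zero]
  intro w hw
  ext ⟨⟨j, i, k⟩, h⟩
  have h1 := lieMap_apply w j i k h
  rw [hw] at h1
  simp only [Pi.zero_apply] at h1
  rw [Finsupp.zero_apply]
  split_ifs at h1
  · linear_combination (2⁻¹) * h1 - w ⟨(j, i, k), h⟩ * hp
  · linear_combination h1

/-- On basis vectors with `r < i` this is the Jacobi identity for tensors; in the other case it is
immediate. -/
theorem lieMap_phi (r : Fin n) (v : VSpace p n) :
    lieMap p n (phi p r v) = bracket (altMap p n v) (Pi.single r 1) := by
  induction v using Finsupp.induction_linear with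
  | zero => funext x y z; simp [bracket, tensorLeft, tensorRight]
  | add v w hv hw =>
    rw [map_add, map_add, map_add, hv, hw]
    funext x y z
    simp only [bracket, LinearMap.coe_mk, AddHom.coe_mk, tensorLeft, tensorRight,
      Pi.sub_apply, Pi.add_apply]
    ring
  | single q c =>
    have hc : Finsupp.single q c = c • Finsupp.single q (1 : ZMod p) := by simp
    have h1 : lieMap p n (phi p r (Finsupp.single q 1)) =
        bracket (altMap p n (Finsupp.single q 1)) (Pi.single r 1) := by
      rw [altMap_single]
      change _ = lieMonomial p _ _ _
      rcases le_or_gt q.1.2 r with hr | hr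
      · simp [phi, hr, lieMap_wBasis]
      · rw [lieMonomial_jacobi]
        simp [phi, not_le.mpr hr, lieMap_wBasis]
    rw [hc, map_smul, map_smul, map_smul, h1]
    funext x y z
    simp only [bracket, LinearMap.coe_mk, AddHom.coe_mk, tensorLeft, tensorRight,
      Pi.sub_apply, Pi.smul_apply, smul_eq_mul]
    ring

/-- When `x.one = 0`, commuting with `y` only requires the bracket of `x.two` with `y.one` to lie in
the image of `Y_X`. This is linear in `y.one`, so it suffices to test coordinate vectors, where it
says `φ_r v ∈ Y_X`. -/
theorem TruncGroup.mem_center_iff (hp : (2 : ZMod p) * 2⁻¹ = 1) (hn : 1 < n)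
    (X : Submodule (ZMod p) (VSpace p n)) (x : TruncGroup ((spaceY X).map (lieMap p n))) :
    x ∈ Subgroup.center _ ↔ x.one = 0 ∧ ∃ v ∈ spaceZ X, altMap p n v = x.two := by
  rw [Subgroup.mem_center_iff]
  have key : ∀ y : TruncGroup ((spaceY X).map (lieMap p n)), x.one = 0 →
      (y * x = x * y ↔ bracket x.two y.one ∈ (spaceY X).map (lieMap p n)) := by
    intro y h1
    rw [eq_comm, mul_comm_iff]
    have h2 : tensorLeft x.one y.two + tensorRight x.two y.one -
        (tensorLeft y.one x.two + tensorRight y.two x.one) = bracket x.two y.one := by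
      funext i j k
      simp [h1, bracket, tensorLeft, tensorRight]
    rw [h2]
    simp [h1]
  have hY : ∀ r v, bracket (altMap p n v) (Pi.single r 1) ∈ (spaceY X).map (lieMap p n) ↔
      phi p r v ∈ spaceY X := by
    intro r v
    rw [← lieMap_phi]
    exact (lieMap_injective hp).mem_set_image
  constructor
  · intro h
    have h1 : x.one = 0 := by
      funext i
      have : Nontrivial (Fin n) := Fin.nontrivial_iff_two_le.mpr hn
      -- A second index exists since `n > 1`; commuting with the generator at `r` forces coordinate
      -- `i` of `x.one` to vanish.
      obtain ⟨r, hr⟩ := exists_ne i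
      have := ((mul_comm_iff _ _).mp (h (gen hp _ r))).1 r i
      simpa [gen, hr, hr.symm] using this
    obtain ⟨v, hv⟩ := exists_altMap hp x.two fun i j => by simp [x.symm_two, h1]
    refine ⟨h1, v, ?_, hv⟩
    refine (Submodule.mem_iInf _).mpr fun r => ?_
    rw [Submodule.mem_comap, ← hY, hv]
    exact (key (gen hp _ r) h1).mp (h _)
  · rintro ⟨h1, v, hv, hv2⟩ y
    rw [key y h1, ← hv2]
    have hle : (⊤ : Submodule (ZMod p) (Fin n → ZMod p)) ≤
        ((spaceY X).map (lieMap p n)).comap (bracket (altMap p n v)) := by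
      rw [← (Pi.basisFun (ZMod p) (Fin n)).span_eq, Submodule.span_le]
      rintro _ ⟨r, rfl⟩
      rw [Pi.basisFun_apply]
      exact (hY r v).mpr ((Submodule.mem_iInf _).mp hv r)
    exact hle Submodule.mem_top

end TruncatedTensors

/-! ### Sufficiency: the kernel of the map to `G` and the center -/

section Sufficiency

variable {p n : ℕ} [Fact p.Prime]

theorem two_mul_inv_two_zmod (hp : p ≠ 2) : (2 : ZMod p) * 2⁻¹ = 1 := by
  refine mul_inv_cancel₀ ?_
  have h : ((2 : ℕ) : ZMod p) ≠ 0 := by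
    rw [Ne, ZMod.natCast_eq_zero_iff, Nat.prime_dvd_prime_iff_eq Fact.out Nat.prime_two]
    exact hp
  exact_mod_cast h

theorem closure_range_gen :
    Subgroup.closure (Set.range (TwoNilProd.gen p n)) = ⊤ := by
  set S := Subgroup.closure (Set.range (TwoNilProd.gen p n))
  rw [eq_top_iff]
  rintro x -
  obtain ⟨x, rfl⟩ := QuotientGroup.mk_surjective x
  induction x using Monoid.CoprodI.induction_on with
  | one => exact one_mem S
  | mul x y hx hy => exact mul_mem hx hy
  | of i a =>
    have h1 : a = (Multiplicative.ofAdd (1 : ZMod p)) ^ (Multiplicative.toAdd a).val := by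
      rw [← ofAdd_nsmul]; simp
    rw [h1, map_pow]
    have h2 : TwoNilProd.gen p n i ∈ S := Subgroup.subset_closure ⟨i, rfl⟩
    exact pow_mem h2 _

theorem forall_commute_of_closure_range {ι G : Type*} [Group G] {g : ι → G}
    (hgen : Subgroup.closure (Set.range g) = ⊤) (hcomm : ∀ i j, g i * g j = g j * g i)
    (x y : G) : x * y = y * x := by
  have h1 : Set.range g ⊆ Subgroup.center G := by
    rintro _ ⟨i, rfl⟩
    have h2 : (⊤ : Subgroup G) ≤ Subgroup.centralizer {g i} := by
      rw [← hgen, Subgroup.closure_le]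
      rintro _ ⟨j, rfl⟩
      exact Subgroup.mem_centralizer_singleton_iff.mpr (hcomm j i)
    exact Subgroup.mem_center_iff.mpr fun y =>
      Subgroup.mem_centralizer_singleton_iff.mp (h2 (Subgroup.mem_top y))
  have h3 : (⊤ : Subgroup G) ≤ Subgroup.center G := by
    rw [← hgen, Subgroup.closure_le]; exact h1
  exact Subgroup.mem_center_iff.mp (h3 (Subgroup.mem_top y)) x

/-- An element of the `2`-nilpotent product with trivial exponent sums is a product of basic
commutators. -/
theorem exists_ofVector_eq (π : TwoNilProd p n →* Multiplicative (Fin n → ZMod p))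
    (hπ : ∀ i, π (TwoNilProd.gen p n i) = Multiplicative.ofAdd (Pi.single i 1))
    (x : TwoNilProd p n) (hx : π x = 1) : ∃ v : VSpace p n, TwoNilProd.ofVector v = x := by
  have hcen : (TwoNilProd.ofVectorHom p n).range ≤ Subgroup.center (TwoNilProd p n) := by
    rintro _ ⟨v, rfl⟩
    exact SetLike.coe_mem _
  have hnormal : (TwoNilProd.ofVectorHom p n).range.Normal := by
    refine ⟨fun d hd y => ?_⟩
    rwa [Subgroup.mem_center_iff.mp (hcen hd) y, mul_inv_cancel_right]
  set D := (TwoNilProd.ofVectorHom p n).range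
  have hgen : Subgroup.closure (Set.range fun i => QuotientGroup.mk' D (TwoNilProd.gen p n i))
      = ⊤ := by
    rw [Set.range_comp' (QuotientGroup.mk' D), ← MonoidHom.map_closure, closure_range_gen,
      Subgroup.map_top_of_surjective _ (QuotientGroup.mk'_surjective D)]
  have hlt : ∀ i j, i < j → rcomm (TwoNilProd.gen p n j) (TwoNilProd.gen p n i) ∈ D := by
    intro i j h
    exact ⟨Multiplicative.ofAdd (Finsupp.single (⟨(j, i), h⟩ : VIndex n) 1),
      ofVector_single (⟨(j, i), h⟩ : VIndex n)⟩
  have hmem : ∀ i j, rcomm (TwoNilProd.gen p n j) (TwoNilProd.gen p n i) ∈ D := by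
    intro i j
    rcases lt_trichotomy i j with h | rfl | h
    · exact hlt i j h
    · rw [(rcomm_eq_one_iff _ _).mpr rfl]; exact one_mem D
    · rw [rcomm_swap]; exact inv_mem (hlt j i h)
  let _ : CommGroup (TwoNilProd p n ⧸ D) :=
    { (inferInstance : Group (TwoNilProd p n ⧸ D)) with
      mul_comm := forall_commute_of_closure_range hgen fun i j => by
        rw [← rcomm_eq_one_iff, ← map_rcomm]
        exact (QuotientGroup.eq_one_iff _).mpr (hmem j i) }
  let s := finsuppLift (p := p) (fun i => QuotientGroup.mk' D (TwoNilProd.gen p n i)) fun i => by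
    rw [← map_pow, TwoNilProd.gen_pow, map_one]
  let e : Multiplicative (Fin n → ZMod p) →* Multiplicative (Fin n →₀ ZMod p) :=
    AddMonoidHom.toMultiplicative
      (Finsupp.linearEquivFunOnFinite (ZMod p) (ZMod p) (Fin n)).symm.toLinearMap.toAddMonoidHom
  -- The quotient by `D` is abelian and its generators are killed by `p`, so the quotient map
  -- factors through the exponent sums `π`.
  have h : QuotientGroup.mk' D = (s.comp e).comp π := by
    apply twoNilProd_hom_ext
    intro i
    have he : e (Multiplicative.ofAdd (Pi.single i 1)) =
        Multiplicative.ofAdd (Finsupp.single i 1) := by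
      change Multiplicative.ofAdd ((Finsupp.linearEquivFunOnFinite (ZMod p) (ZMod p)
        (Fin n)).symm (Pi.single i 1)) = _
      rw [Finsupp.linearEquivFunOnFinite_symm_single]
    rw [MonoidHom.comp_apply, MonoidHom.comp_apply, hπ, he]
    exact (finsuppLift_single (p := p)
      (fun i => QuotientGroup.mk' D (TwoNilProd.gen p n i)) _ i).symm
  have h1 : QuotientGroup.mk' D x = 1 := by
    rw [h, MonoidHom.comp_apply, hx, map_one]
  exact (QuotientGroup.eq_one_iff x).mp h1

open scoped commutatorElement in
/-- In a group of class at most two, the derived subgroup consists of non-generators. -/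
theorem eq_top_of_forall_exists_mul_center {G : Type*} [Group G]
    (hG : (⊤ : Subgroup G).lowerCentralSeries 2 = ⊥) (K : Subgroup G)
    (h : K ⊔ (⊤ : Subgroup G).lowerCentralSeries 1 = ⊤) : K = ⊤ := by
  have hc : (⊤ : Subgroup G).lowerCentralSeries 1 ≤ Subgroup.center G := by
    refine (Subgroup.commutator_le.mpr ?_ : ⁅(⊤ : Subgroup G), (⊤ : Subgroup G)⁆ ≤ _)
    intro x _ y _
    have := rcomm_mem_center hG x⁻¹ y⁻¹
    rwa [rcomm_eq, inv_inv, inv_inv] at this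
  have hex : ∀ x : G, ∃ k ∈ K, ∃ z ∈ Subgroup.center G, k * z = x := by
    intro x
    have hx : x ∈ K ⊔ (⊤ : Subgroup G).lowerCentralSeries 1 := by
      rw [h]; exact Subgroup.mem_top x
    obtain ⟨k, hk, z, hz, rfl⟩ := Subgroup.mem_sup_of_normal_right.mp hx
    exact ⟨k, hk, z, hc hz, rfl⟩
  -- Every element is in `K` up to a central factor, so every commutator in `G` is already a
  -- commutator in `K`.
  have hle : (⊤ : Subgroup G).lowerCentralSeries 1 ≤ K := by
    refine (Subgroup.commutator_le.mpr ?_ : ⁅(⊤ : Subgroup G), (⊤ : Subgroup G)⁆ ≤ _)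
    intro x _ y _
    obtain ⟨k, hk, z, hz, rfl⟩ := hex x
    obtain ⟨l, hl, w, hw, rfl⟩ := hex y
    have hzl := Subgroup.mem_center_iff.mp hz
    have hwl := Subgroup.mem_center_iff.mp hw
    have h1 : k * z * (l * w) = k * l * (z * w) := by
      rw [mul_assoc, ← mul_assoc z, ← hzl l]; group
    have h2 : l * w * (k * z) = l * k * (z * w) := by
      rw [mul_assoc, ← mul_assoc w, ← hwl k, mul_assoc k, ← hzl w]; group
    have h3 : ⁅k * z, l * w⁆ = k * l * (l * k)⁻¹ := by
      have : ⁅k * z, l * w⁆ = k * z * (l * w) * (l * w * (k * z))⁻¹ := by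
        rw [commutatorElement_def]; group
      rw [this, h1, h2]; group
    rw [h3]
    exact mul_mem (mul_mem hk hl) (inv_mem (mul_mem hl hk))
  rwa [sup_eq_left.mpr hle] at h

open scoped commutatorElement in
-- A relation whose exponent at `x_k` is nonzero mod `p` would put `g_k` into the subgroup generated
-- by the other `g_i` and `G'`. As `G'` consists of non-generators, the other `n - 1` elements would
-- generate `G`, against minimality.
theorem exponentSum_eq_zero_of_naturalMap_eq_one {G : Type u} [Group G]
    (hclass : (⊤ : Subgroup G).lowerCentralSeries 2 = ⊥) (g : Fin n → G)
    (hg : ∀ i, g i ^ p = 1) (hmin : MinimallyGenerates g)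
    (π : TwoNilProd p n →* Multiplicative (Fin n → ZMod p))
    (hπ : ∀ i, π (TwoNilProd.gen p n i) = Multiplicative.ofAdd (Pi.single i 1))
    (x : TwoNilProd p n) (hx : naturalMap hclass g hg x = 1) : π x = 1 := by
  change Multiplicative.toAdd (π x) = 0
  funext k
  by_contra hk
  obtain ⟨m, rfl⟩ : ∃ m, n = m + 1 := ⟨n - 1, by have := k.pos; omega⟩
  let K : Subgroup G := Subgroup.closure (Set.range fun i => g (k.succAbove i))
  refine hmin.2 m (Nat.lt_succ_self m) (fun i => g (k.succAbove i)) ?_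
  refine eq_top_of_forall_exists_mul_center hclass K ?_
  set M := K ⊔ (⊤ : Subgroup G).lowerCentralSeries 1
  have hM1 : (⊤ : Subgroup G).lowerCentralSeries 1 ≤ M := le_sup_right
  have hMn : M.Normal := by
    refine ⟨fun a ha y => ?_⟩
    have h1 : ⁅y, a⁆ ∈ M := hM1 (Subgroup.commutator_mem_commutator
      (Subgroup.mem_top _) (Subgroup.mem_top _))
    have h2 : y * a * y⁻¹ = ⁅y, a⁆ * a := by rw [commutatorElement_def]; group
    rw [h2]; exact mul_mem h1 ha
  have hgk : ∀ i, i ≠ k → QuotientGroup.mk' M (g i) = 1 := by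
    intro i hi
    obtain ⟨j, rfl⟩ := Fin.exists_succAbove_eq hi
    refine (QuotientGroup.eq_one_iff _).mpr ?_
    exact (le_sup_left : K ≤ M) (Subgroup.subset_closure ⟨j, rfl⟩)
  have hkp : QuotientGroup.mk' M (g k) ^ p = 1 := by rw [← map_pow, hg, map_one]
  let ev : Multiplicative (Fin (m + 1) → ZMod p) →* Multiplicative (ZMod p) :=
    AddMonoidHom.toMultiplicative (Pi.evalAddMonoidHom (fun _ => ZMod p) k)
  -- Modulo `M` every generator but `g_k` dies, so only the exponent at `k` survives.
  have hhom : (QuotientGroup.mk' M).comp (naturalMap hclass g hg) =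
      ((cyclicLift (QuotientGroup.mk' M (g k)) hkp).comp ev).comp π := by
    apply twoNilProd_hom_ext
    intro i
    simp only [MonoidHom.comp_apply, naturalMap_gen, hπ]
    change _ = QuotientGroup.mk' M (g k) ^
      ((Pi.single i 1 : Fin (m + 1) → ZMod p) k).val
    by_cases hi : i = k
    · subst hi
      rw [Pi.single_eq_same, ZMod.val_one_eq_one_mod, ← pow_eq_pow_mod _ hkp, pow_one]
    · rw [Pi.single_eq_of_ne (Ne.symm hi), ZMod.val_zero, pow_zero, hgk i hi]
  have h1 : QuotientGroup.mk' M (g k) ^ (Multiplicative.toAdd (π x) k).val = 1 := by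
    have := DFunLike.congr_fun hhom x
    simp only [MonoidHom.comp_apply, hx, map_one] at this
    exact this.symm
  have h2 : QuotientGroup.mk' M (g k) = 1 := by
    have hcop : Nat.Coprime (Multiplicative.toAdd (π x) k).val p := by
      rw [Nat.coprime_comm, (Fact.out : p.Prime).coprime_iff_not_dvd,
        ← ZMod.natCast_eq_zero_iff, ZMod.natCast_zmod_val]
      exact hk
    have := pow_gcd_eq_one.mpr ⟨h1, hkp⟩
    rwa [hcop.gcd_eq_one, pow_one] at this
  rw [eq_top_iff, ← hmin.1, Subgroup.closure_le]
  rintro _ ⟨i, rfl⟩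
  by_cases hi : i = k
  · subst hi; exact (QuotientGroup.eq_one_iff _).mp h2
  · exact (QuotientGroup.eq_one_iff _).mp (hgk i hi)

namespace TruncGroup

/-- The natural isomorphism from the `2`-nilpotent product to the group of truncated tensors. -/
noncomputable def fromTwoNilProd (hp : (2 : ZMod p) * 2⁻¹ = 1) :
    TwoNilProd p n →* TruncGroup (⊤ : Submodule (ZMod p) (TensorThree p n)) :=
  naturalMap lowerCentralSeries_two (gen hp ⊤) (gen_pow hp)

theorem fromTwoNilProd_gen (hp : (2 : ZMod p) * 2⁻¹ = 1) (i : Fin n) :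
    fromTwoNilProd hp (TwoNilProd.gen p n i) = gen hp ⊤ i :=
  naturalMap_gen _ _ _ i

theorem rcomm_two {Y : Submodule (ZMod p) (TensorThree p n)} (x y : TruncGroup Y) :
    (rcomm x y).one = 0 ∧
      (rcomm x y).two = fun i j => x.one i * y.one j - y.one i * x.one j := by
  have h0 : (rcomm x y).one = 0 := by
    have := congrArg TruncGroup.one (rcomm_self_mul x y)
    simp only [mul_one'] at this
    rw [add_comm y.one] at this
    exact left_eq_add.mp this
  refine ⟨h0, ?_⟩
  funext i j
  have := congrFun (congrFun (congrArg TruncGroup.two (rcomm_self_mul x y)) i) j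
  simp only [mul_two, mul_one', h0, Pi.zero_apply, mul_zero, add_zero] at this
  linear_combination -this

theorem fromTwoNilProd_ofVector (hp : (2 : ZMod p) * 2⁻¹ = 1) (v : VSpace p n) :
    (fromTwoNilProd hp (TwoNilProd.ofVector v)).one = 0 ∧
      (fromTwoNilProd hp (TwoNilProd.ofVector v)).two = altMap p n v := by
  let f : Multiplicative (VSpace p n) →*
      TruncGroup (⊤ : Submodule (ZMod p) (TensorThree p n)) :=
    { toFun := fun v =>
        { one := 0
          two := altMap p n (Multiplicative.toAdd v)
          three := 0
          symm_two := fun i j => by simp [altMap_antisymm] }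
      map_one' := ext_top rfl (map_zero _)
      map_mul' := fun v w => ext_top (by simp) (by
        funext i j
        simp [mul_two, toAdd_mul]) }
  have h : (fromTwoNilProd hp).comp (TwoNilProd.ofVectorHom p n) = f := by
    apply monoidHom_finsupp_ext
    intro q
    change fromTwoNilProd hp (TwoNilProd.ofVector (Finsupp.single q 1)) = _
    rw [ofVector_single, map_rcomm, fromTwoNilProd_gen, fromTwoNilProd_gen]
    apply ext_top
    · exact (rcomm_two _ _).1
    · rw [(rcomm_two _ _).2]
      change _ = altMap p n (Finsupp.single q 1)
      rw [altMap_single]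
      funext i j
      simp [gen, unitTwo]
  have h1 := DFunLike.congr_fun h (Multiplicative.ofAdd v)
  have h2 : fromTwoNilProd hp (TwoNilProd.ofVector v) = f (Multiplicative.ofAdd v) := h1
  rw [h2]
  exact ⟨rfl, rfl⟩

theorem oneHom_fromTwoNilProd_gen (hp : (2 : ZMod p) * 2⁻¹ = 1) (i : Fin n) :
    ((oneHom ⊤).comp (fromTwoNilProd hp)) (TwoNilProd.gen p n i) =
      Multiplicative.ofAdd (Pi.single i 1) := by
  rw [MonoidHom.comp_apply, fromTwoNilProd_gen]; rfl

/-- Degree one reads off the exponent sums. When they vanish, the element is a product of basic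
commutators, and degree two recovers its vector through `altMap`, which is onto the antisymmetric
tensors. -/
theorem fromTwoNilProd_bijective (hp : (2 : ZMod p) * 2⁻¹ = 1) :
    Function.Bijective (fromTwoNilProd (n := n) hp) := by
  constructor
  · rw [injective_iff_map_eq_one]
    intro x hx
    obtain ⟨v, rfl⟩ := exists_ofVector_eq _ (oneHom_fromTwoNilProd_gen hp) x (by
      rw [MonoidHom.comp_apply, hx, map_one])
    have h1 := (fromTwoNilProd_ofVector hp v).2
    rw [hx] at h1
    have h2 : v = 0 := altMap_injective (by rw [← h1, map_zero]; rfl)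
    rw [h2, TwoNilProd.ofVector_zero]
  · intro y
    have h1 : ∃ x, (fromTwoNilProd (n := n) hp x).one = y.one := by
      let S : Submodule (ZMod p) (Fin n → ZMod p) := AddSubgroup.toZModSubmodule p
        (Subgroup.toAddSubgroup' ((oneHom ⊤).comp (fromTwoNilProd (n := n) hp)).range)
      have hS : ⊤ ≤ S := by
        rw [← (Pi.basisFun (ZMod p) (Fin n)).span_eq, Submodule.span_le]
        rintro _ ⟨r, rfl⟩
        rw [Pi.basisFun_apply]
        exact ⟨_, oneHom_fromTwoNilProd_gen hp r⟩
      obtain ⟨x, hx⟩ := hS (Submodule.mem_top : y.one ∈ ⊤)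
      exact ⟨x, hx⟩
    obtain ⟨x, hx⟩ := h1
    set z := (fromTwoNilProd hp x)⁻¹ * y with hz
    have hz1 : z.one = 0 := by rw [hz, mul_one', inv_one', hx, neg_add_cancel]
    obtain ⟨v, hv⟩ := exists_altMap hp z.two fun i j => by simp [z.symm_two, hz1]
    refine ⟨x * TwoNilProd.ofVector v, ?_⟩
    have h2 : fromTwoNilProd hp (TwoNilProd.ofVector v) = z :=
      ext_top ((fromTwoNilProd_ofVector hp v).1.trans hz1.symm)
        ((fromTwoNilProd_ofVector hp v).2.trans hv)
    rw [map_mul, h2, hz, mul_inv_cancel_left]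

end TruncGroup

theorem isCapable_of_surjective {G : Type u} [Group G] {H : Type} [Group H] (θ : H →* G)
    (hθ : Function.Surjective θ) (hker : θ.ker = Subgroup.center H) : IsCapable.{u, v} G := by
  -- The witness is built in `Type`, while `IsCapable.{u, v}` asks for a group in `Type v`.
  let u : ULift.{v} H ≃* H := MulEquiv.ulift
  let θ' := θ.comp u.toMonoidHom
  have hsurj : Function.Surjective θ' := hθ.comp u.surjective
  have hk : θ'.ker = Subgroup.center (ULift.{v} H) := by
    ext x
    have h1 : x ∈ θ'.ker ↔ u x ∈ θ.ker := Iff.rfl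
    rw [h1, hker, Subgroup.mem_center_iff, Subgroup.mem_center_iff]
    constructor
    · intro h y
      exact u.injective (by rw [map_mul, map_mul, h])
    · intro h y
      obtain ⟨y, rfl⟩ := u.surjective y
      rw [← map_mul, h, map_mul]
  exact ⟨ULift.{v} H, inferInstance, ⟨(QuotientGroup.quotientKerEquivOfSurjective θ' hsurj).symm.trans
    (QuotientGroup.quotientMulEquivOfEq hk)⟩⟩

theorem isCapable_of_commRelSpace_eq_spaceZ (hp : p ≠ 2) {G : Type u} [Group G]
    (hclass : (⊤ : Subgroup G).lowerCentralSeries 2 = ⊥) (hn : 1 < n) (g : Fin n → G)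
    (hg : ∀ i, g i ^ p = 1) (hmin : MinimallyGenerates g)
    (hX : commRelSpace hclass g hg = spaceZ (commRelSpace hclass g hg)) :
    IsCapable.{u, v} G := by
  have h2 := two_mul_inv_two_zmod hp
  set X := commRelSpace hclass g hg
  let e := MulEquiv.ofBijective _ (TruncGroup.fromTwoNilProd_bijective (p := p) (n := n) h2)
  let θ : TruncGroup ((spaceY X).map (lieMap p n)) →* G :=
    ((naturalMap hclass g hg).comp e.symm.toMonoidHom).comp (TruncGroup.projTop _)
  refine isCapable_of_surjective θ ?_ ?_
  · exact ((naturalMap_surjective hclass g hg hmin.1).comp e.symm.surjective).comp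
      TruncGroup.projTop_surjective
  ext x
  rw [TruncGroup.mem_center_iff h2 hn, ← hX, MonoidHom.mem_ker]
  obtain ⟨y, hy⟩ := e.surjective (TruncGroup.projTop _ x)
  have hθ : θ x = naturalMap hclass g hg y := by
    change naturalMap hclass g hg (e.symm (TruncGroup.projTop _ x)) = _
    rw [← hy, e.symm_apply_apply]
  have hy1 : (TruncGroup.fromTwoNilProd h2 y).one = x.one := congrArg TruncGroup.one hy
  have hy2 : (TruncGroup.fromTwoNilProd h2 y).two = x.two := congrArg TruncGroup.two hy
  rw [hθ, ← hy1, ← hy2]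
  have hex : (TruncGroup.fromTwoNilProd h2 y).one = 0 →
      ∃ v : VSpace p n, TwoNilProd.ofVector v = y := fun h =>
    exists_ofVector_eq _ (TruncGroup.oneHom_fromTwoNilProd_gen h2) y h
  constructor
  · intro h
    have h1 : (TruncGroup.fromTwoNilProd h2 y).one = 0 :=
      exponentSum_eq_zero_of_naturalMap_eq_one hclass g hg hmin _
        (TruncGroup.oneHom_fromTwoNilProd_gen h2) y h
    obtain ⟨v, rfl⟩ := hex h1
    exact ⟨h1, v, (mem_commRelSpace hclass g hg v).mpr h,
      (TruncGroup.fromTwoNilProd_ofVector h2 v).2.symm⟩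
  · rintro ⟨h1, v, hv, hv2⟩
    obtain ⟨w, rfl⟩ := hex h1
    rw [(TruncGroup.fromTwoNilProd_ofVector h2 w).2] at hv2
    -- Both `v ∈ X` and the vector `w` of `y` have the same antisymmetric tensor, so they coincide.
    rw [← altMap_injective hv2]
    exact (mem_commRelSpace hclass g hg v).mp hv

end Sufficiency

theorem mainTheorem2 (p : ℕ) [Fact p.Prime] (hp : p ≠ 2)
    (G : Type u) [Group G] [Finite G]
    (hclass : (⊤ : Subgroup G).lowerCentralSeries 2 = ⊥)
    (hexp : Monoid.exponent G = p)
    (n : ℕ) (hn : 1 < n) (g : Fin n → G) (hg : MinimallyGenerates g) :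
    IsCapable.{u, v} G ↔
      commRelSpace hclass g (fun i => hexp ▸ Monoid.pow_exponent_eq_one (g i)) =
        spaceZ (commRelSpace hclass g (fun i => hexp ▸ Monoid.pow_exponent_eq_one (g i))) := by
  have hgp : ∀ i, g i ^ p = 1 := fun i => hexp ▸ Monoid.pow_exponent_eq_one (g i)
  have hall : ∀ x : G, x ^ p = 1 := fun x => hexp ▸ Monoid.pow_exponent_eq_one x
  constructor
  · rintro ⟨H, _, ⟨e⟩⟩
    exact commRelSpace_eq_spaceZ_of_mulEquiv hclass g hgp hg.1 hall e
  · exact isCapable_of_commRelSpace_eq_spaceZ hp hclass hn g hgp hg
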